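/- Let $(W,S)$ be a Coxeter system with $S$ finite and Coxeter matrix $(m_{st})$, and let $M\subseteq S$. Call $(W,S)$ definite if the bilinear form on $\mathbb{R}^S$ given by $B(e_s,e_t)=-\cos(\pi/m_{st})$ is positive definite. For $J\subseteq S$ put $W_J=\langle J\rangle$. The Wythoffian polytope $\mathcal{P}_{W,M}$ is the following poset. Its vertices are the elements $w x_0$ $(w\in W)$ of the $W$-orbit of a point $x_0$ with stabiliser $W_{S\setminus M}$. Its faces are the empty set and the sets $wW_Jx_0$ with $w\in W$ and $J\subseteq S$, ordered by inclusion. The link of a face $F$ is the section between $F$ and the greatest face. The $1$-skeleton $X$ is the graph on the vertices whose edges are the pairs $\{wx_0,wsx_0\}$ with $w\in W$, $s\in M$. For $N\trianglelefteq W$, the quotient graph $X/N$ has as vertices the $N$-orbits of vertices of $X$, two distinct orbits being adjacent if they contain adjacent vertices. A graph is $(a_0,\dots,a_n)$-regular ($a_i$ cardinals) if every vertex has exactly $a_0$ neighbours and, when $n\ge 1$, for each vertex $v$ the full subgraph induced on the neighbours of $v$ is $(a_1,\dots,a_n)$-regular; by convention the empty graph is $0$-regular but not $d$-regular for $d\neq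 0$. Suppose that $(W,S)$ is not definite, that the link of every vertex of $\mathcal{P}_{W,M}$ is finite, and that the subgroup of $W$ generated by those $s\in S$ whose connected component in the Coxeter diagram contains no element of $M$ is finite (this is automatic when $M$ meets every connected component of the diagram). Suppose that $X$ is $(a_0,\dots,a_n)$-regular. Let $\{N_m\}_{m\in I}$ be a family of finite-index normal subgroups of $W$ which is closed under (pairwise) intersection and satisfies $\bigcap_{m\in I}N_m=\{1\}$. Then there exists $I'\subseteq I$ such that $\{N_m\}_{m\in I'}$ is closed under intersection, $\bigcap_{m\in I'}N_m=\{1\}$, for every $m\in I'$ the quotient graph $X/N_m$ is finite and $(a_0,\dots,a_n)$-regular, and the sizes of the graphs $X/N_m$ $(m\in I')$ are unbounded. -/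

import Mathlib

universe u v

open scoped Pointwise

/-! ### Regularity of graphs -/

/-- A graph is `a`-regular, for a cardinal `a`, if each vertex has exactly `a` neighbours; by
convention the empty graph is `0`-regular only. -/
def IsCardRegular {V : Type u} (G : SimpleGraph V) (a : Cardinal.{u}) : Prop :=
  (∀ x : V, Cardinal.mk (G.neighborSet x) = a) ∧ (IsEmpty V → a = 0)

/-- `IsHighlyRegular [a₀, …, aₙ] G`: the graph `G` is `(a₀, …, aₙ)`-regular, that is, `G` is
`a₀`-regular and the full subgraph on the neighbours of each vertex is `(a₁, …, aₙ)`-regular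
(no condition is left once the list is exhausted). -/
def IsHighlyRegular : List Cardinal.{u} → ∀ {V : Type u}, SimpleGraph V → Prop
  | [], _, _ => True
  | a :: l, V, G =>
      IsCardRegular G a ∧ ∀ x : V, IsHighlyRegular l (G.induce (G.neighborSet x))

/-- The quotient of a graph by a group acting on its vertices: the vertices are the orbits, and two
distinct orbits are adjacent when some representatives of them are adjacent. -/
def orbitGraph (N : Type*) [Group N] {V : Type u} [MulAction N V] (G : SimpleGraph V) :
    SimpleGraph (MulAction.orbitRel.Quotient N V) where
  Adj p q := p ≠ q ∧ ∃ x y : V, p = Quotient.mk'' x ∧ q = Quotient.mk'' y ∧ G.Adj x y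
  symm := ⟨fun _ _ h => by
    obtain ⟨hne, x, y, hx, hy, hxy⟩ := h
    exact ⟨hne.symm, y, x, hy, hx, hxy.symm⟩⟩
  loopless := ⟨fun _ h => h.1 rfl⟩

/-! ### Coxeter systems -/

namespace CoxeterMatrix

variable {B : Type v} (C : CoxeterMatrix B)

/-- The Gram matrix `(-cos (π / m_{st}))` of the canonical bilinear form on `ℝ^S`. Mathlib encodes
`m_{st} = ∞` by the entry `0`; the corresponding entry is `-cos 0 = -1`. -/
noncomputable def gramMatrix : Matrix B B ℝ :=
  Matrix.of fun s t => if C s t = 0 then -1 else -Real.cos (Real.pi / (C s t : ℝ))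

/-- The Coxeter system is definite. Since the diagonal entries of the form are `1`, definite means
positive definite. -/
def IsDefinite : Prop := C.gramMatrix.PosDef

/-- The graph underlying the Coxeter diagram: `s ≠ t` are joined when `m_{st} ≥ 3` or
`m_{st} = ∞`, that is, when `m_{st} ≠ 2`. -/
def diagram : SimpleGraph B where
  Adj s t := s ≠ t ∧ C s t ≠ 2
  symm := ⟨fun s t h => ⟨h.1.symm, by rw [C.symmetric t s]; exact h.2⟩⟩
  loopless := ⟨fun _ h => h.1 rfl⟩

/-- The nodes of the Coxeter diagram whose connected component contains no element of `M`. -/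
def unreachedNodes (M : Set B) : Set B := {t | ∀ s ∈ M, ¬ C.diagram.Reachable t s}

end CoxeterMatrix

namespace CoxeterSystem

variable {B : Type v} {C : CoxeterMatrix B} {W : Type u} [Group W] (cs : CoxeterSystem C W)

/-- The standard parabolic subgroup `W_J` generated by `J ⊆ S`. -/
def parabolic (J : Set B) : Subgroup W := Subgroup.closure (cs.simple '' J)

/-! ### Wythoffian polytopes -/

/-- The vertices of the Wythoffian polytope `P_{W,M}`: the orbit `W x₀` of the standard vertex,
whose stabiliser is the parabolic subgroup generated by `S \ M`. -/
abbrev WythoffVertex (M : Set B) : Type u := W ⧸ cs.parabolic Mᶜ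

/-- The standard vertex `x₀`. -/
def baseVertex (M : Set B) : cs.WythoffVertex M := QuotientGroup.mk 1

/-- The standard face of `J ⊆ S`, given by its set of vertices `W_J x₀`. -/
def standardFace (M J : Set B) : Set (cs.WythoffVertex M) :=
  {x | ∃ w ∈ cs.parabolic J, x = w • cs.baseVertex M}

/-- The faces of `P_{W,M}`: the empty face and the images of the standard faces under `W`. -/
def IsWythoffFace (M : Set B) (F : Set (cs.WythoffVertex M)) : Prop :=
  F = ∅ ∨ ∃ (w : W) (J : Set B), F = w • cs.standardFace M J

/-- The Wythoffian polytope `P_{W,M}`, as the poset of its faces, each given by its set of vertices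
and ordered by inclusion. -/
abbrev WythoffPolytope (M : Set B) : Type u :=
  {F : Set (cs.WythoffVertex M) // cs.IsWythoffFace M F}

theorem isWythoffFace_singleton (M : Set B) (x : cs.WythoffVertex M) :
    cs.IsWythoffFace M {x} := by
  obtain ⟨w, rfl⟩ := QuotientGroup.mk_surjective x
  refine Or.inr ⟨w, ∅, ?_⟩
  have h : cs.standardFace M ∅ = {cs.baseVertex M} := by
    ext y
    simp [standardFace, parabolic]
  rw [h, Set.smul_set_singleton]
  simp [baseVertex]

theorem isWythoffFace_univ (M : Set B) : cs.IsWythoffFace M Set.univ := by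
  refine Or.inr ⟨1, Set.univ, ?_⟩
  rw [one_smul]
  symm
  rw [Set.eq_univ_iff_forall]
  intro x
  obtain ⟨w, rfl⟩ := QuotientGroup.mk_surjective x
  refine ⟨w, ?_, by simp [baseVertex]⟩
  rw [parabolic, Set.image_univ, cs.subgroup_closure_range_simple]
  exact Subgroup.mem_top w

/-- A vertex, as a face of the polytope. -/
def vertexFace (M : Set B) (x : cs.WythoffVertex M) : cs.WythoffPolytope M :=
  ⟨{x}, cs.isWythoffFace_singleton M x⟩

/-- The greatest face. -/
def greatestFace (M : Set B) : cs.WythoffPolytope M :=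
  ⟨Set.univ, cs.isWythoffFace_univ M⟩

/-- The link of a face `F` in the polytope: the section between `F` and the greatest face. -/
def faceLink (M : Set B) (F : cs.WythoffPolytope M) : Set (cs.WythoffPolytope M) :=
  Set.Icc F (cs.greatestFace M)

/-- The polytope `P_{W,M}` has finite vertex links. -/
def HasFiniteVertexLinks (M : Set B) : Prop :=
  ∀ x : cs.WythoffVertex M, (cs.faceLink M (cs.vertexFace M x)).Finite

/-- The `1`-skeleton of `P_{W,M}`: the edges are the images under `W` of the standard edges, which
join `x₀` to its reflections `s x₀` for `s ∈ M`. -/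
def wythoffSkeleton (M : Set B) : SimpleGraph (cs.WythoffVertex M) where
  Adj x y := x ≠ y ∧ ∃ (w : W) (s : B), s ∈ M ∧
    x = w • cs.baseVertex M ∧ y = w • cs.simple s • cs.baseVertex M
  symm := ⟨fun x y h => by
    obtain ⟨hne, w, s, hs, hx, hy⟩ := h
    refine ⟨hne.symm, w * cs.simple s, s, hs, ?_, ?_⟩
    · rw [hy, mul_smul]
    · rw [hx, mul_smul, ← mul_smul (cs.simple s) (cs.simple s), cs.simple_mul_simple_self,
        one_smul]⟩
  loopless := ⟨fun _ h => h.1 rfl⟩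

end CoxeterSystem

/-!
The theorem reduces to two finiteness statements about the Coxeter system.

*The group is infinite.* The geometric representation of a finite Coxeter group preserves an inner
product. Since each simple reflection is orthogonal for it, it agrees with the canonical form up to
rescaling the basis vectors, so that the canonical form is positive definite
(`CoxeterSystem.isDefinite_of_finite`).

*The vertex stabiliser `P`, generated by `S \ M`, is finite*
(`CoxeterSystem.finite_parabolic_compl`). Finite vertex links leave only finitely many edges at the
standard vertex, so that the subgroup `Q` of `P` fixing all its neighbours has finite index in `P`.
Now suppose that `g` and `t g t` both lie in the parabolic subgroup generated by `S \ {t}`. Then `t`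
commutes with every letter of a reduced word of `g`, by the exchange condition and the geometric
representation; hence no neighbour of `t` in the diagram occurs in `g`. As `Q` is normal in `P`, and
`t Q t ⊆ P` for `t ∈ M`, following the paths of the diagram that start in `M` shows that the elements
of `Q` involve only letters that are not reached from `M`. By hypothesis these generate a finite
group.

It follows that the skeleton `X` is infinite and locally finite, and that only finitely many elements
of `W` move the standard vertex by a distance of at most `3`. The family separates finite sets from
`1`, so some `N m₀` contains none of these elements except `1`. For each normal subgroup `N m` inside
`N m₀`, the map from `X` to its orbit graph then sends the neighbourhood of each vertex
isomorphically onto the neighbourhood of its orbit, and regularity descends. Separating the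
elements that carry one of `k + 1` given vertices to another yields quotients with more than `k`
vertices.
-/

/-! ### The geometric representation -/

namespace CoxeterMatrix

variable {B : Type v} (C : CoxeterMatrix B)

theorem gramMatrix_self (s : B) : C.gramMatrix s s = 1 := by
  simp [gramMatrix]

theorem gramMatrix_comm (s t : B) : C.gramMatrix s t = C.gramMatrix t s := by
  simp [gramMatrix, C.symmetric s t]

/-- The cosine of `π / m` vanishes for no integer `m ≥ 1` other than `2`. -/
theorem eq_two_of_gramMatrix_eq_zero {s t : B} (h : C.gramMatrix s t = 0) : C s t = 2 := by
  by_cases h0 : C s t = 0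
  · simp [gramMatrix, h0] at h
  have hcos : Real.cos (Real.pi / (C s t : ℝ)) = 0 := by simpa [gramMatrix, h0] using h
  by_cases h1 : C s t = 1
  · simp [h1] at hcos
  by_contra h2
  have h3 : (3 : ℝ) ≤ C s t := by exact_mod_cast (by omega : 3 ≤ C s t)
  have hlt : Real.pi / (C s t : ℝ) < Real.pi / 2 :=
    div_lt_div_of_pos_left Real.pi_pos (by norm_num) (by linarith)
  have hpos : 0 < Real.pi / (C s t : ℝ) := div_pos Real.pi_pos (by linarith)
  exact (Real.cos_pos_of_mem_Ioo ⟨by linarith, hlt⟩).ne' hcos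

/-- The coroot of `s`: twice the pairing `v ↦ B(e_s, v)` with a basis vector. -/
noncomputable def coroot (s : B) : Module.Dual ℝ (B →₀ ℝ) :=
  Finsupp.linearCombination ℝ fun t => 2 * C.gramMatrix s t

theorem coroot_single (s t : B) :
    C.coroot s (Finsupp.single t 1) = 2 * C.gramMatrix s t := by
  simp [coroot]

theorem coroot_single_self (s : B) : C.coroot s (Finsupp.single s 1) = 2 := by
  rw [coroot_single, gramMatrix_self, mul_one]

/-- The reflection of `ℝ^S` attached to `s`, orthogonal for the canonical form. -/
noncomputable def simpleReflection (s : B) : (B →₀ ℝ) ≃ₗ[ℝ] (B →₀ ℝ) :=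
  Module.reflection (C.coroot_single_self s)

theorem simpleReflection_apply (s : B) (v : B →₀ ℝ) :
    C.simpleReflection s v = v - C.coroot s v • Finsupp.single s 1 :=
  Module.reflection_apply v _

/-- The coefficients by which `(σ_s σ_t) ^ m` differs from the identity, polynomials in
`2 cos (2π / m)`, vanish. For `m ≥ 3` the values of the Chebyshev polynomials can be read off from
`S_n(2 cos θ) sin θ = sin ((n + 1) θ)`, as `sin θ ≠ 0`. -/
theorem chebyshev_S_eval_eq_zero {m : ℕ} (hm : 3 ≤ m) :
    ((Polynomial.Chebyshev.S ℝ (((m : ℤ) - 2) / 2)).eval (2 * Real.cos (2 * Real.pi / m)) *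
      ((Polynomial.Chebyshev.S ℝ (((m : ℤ) - 1) / 2)).eval (2 * Real.cos (2 * Real.pi / m)) +
       (Polynomial.Chebyshev.S ℝ (((m : ℤ) - 3) / 2)).eval (2 * Real.cos (2 * Real.pi / m))) = 0) ∧
    ((Polynomial.Chebyshev.S ℝ (((m : ℤ) - 1) / 2)).eval (2 * Real.cos (2 * Real.pi / m)) *
      ((Polynomial.Chebyshev.S ℝ ((m : ℤ) / 2)).eval (2 * Real.cos (2 * Real.pi / m)) +
       (Polynomial.Chebyshev.S ℝ (((m : ℤ) - 2) / 2)).eval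
        (2 * Real.cos (2 * Real.pi / m))) = 0) := by
  have hm' : (3 : ℝ) ≤ m := by exact_mod_cast hm
  have hm0 : (m : ℝ) ≠ 0 := by positivity
  set θ : ℝ := 2 * Real.pi / m with hθ
  have hpos : 0 < θ := by positivity
  have hlt : θ < Real.pi := by
    rw [hθ, div_lt_iff₀ (by linarith)]
    nlinarith [Real.pi_pos]
  have hsin : Real.sin θ ≠ 0 := (Real.sin_pos_of_pos_of_lt_pi hpos hlt).ne'
  have key := Polynomial.Chebyshev.S_two_mul_real_cos θ
  rcases Nat.even_or_odd' m with ⟨k, rfl | rfl⟩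
  · have hz : (Polynomial.Chebyshev.S ℝ ((k : ℤ) - 1)).eval (2 * Real.cos θ) = 0 := by
      have h := key ((k : ℤ) - 1)
      have hk : ((((k : ℤ) - 1 : ℤ) : ℝ) + 1) * θ = Real.pi := by
        push_cast at hm0 ⊢
        rw [hθ]
        push_cast
        have : (k : ℝ) ≠ 0 := fun h => hm0 (by simp [h])
        field_simp
        ring
      rw [hk, Real.sin_pi] at h
      exact (mul_eq_zero.mp h).resolve_right hsin
    have e1 : (((2 * k : ℕ) : ℤ) - 2) / 2 = (k : ℤ) - 1 := by push_cast; omega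
    have e2 : (((2 * k : ℕ) : ℤ) - 1) / 2 = (k : ℤ) - 1 := by push_cast; omega
    rw [e1, e2, hz]
    simp
  · have hz : (Polynomial.Chebyshev.S ℝ (k : ℤ)).eval (2 * Real.cos θ) +
        (Polynomial.Chebyshev.S ℝ ((k : ℤ) - 1)).eval (2 * Real.cos θ) = 0 := by
      have h1 := key (k : ℤ)
      have h2 := key ((k : ℤ) - 1)
      have hk : ((((k : ℤ) : ℤ) : ℝ) + 1) * θ =
          2 * Real.pi - ((((k : ℤ) - 1 : ℤ) : ℝ) + 1) * θ := by
        rw [hθ]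
        push_cast at hm0 ⊢
        field_simp
        ring
      rw [hk, Real.sin_two_pi_sub] at h1
      refine (mul_eq_zero.mp ?_).resolve_right hsin
      rw [add_mul, h1, h2]
      ring
    have e1 : (((2 * k + 1 : ℕ) : ℤ) - 2) / 2 = (k : ℤ) - 1 := by push_cast; omega
    have e2 : (((2 * k + 1 : ℕ) : ℤ) - 1) / 2 = (k : ℤ) := by push_cast; omega
    have e3 : (((2 * k + 1 : ℕ) : ℤ) - 3) / 2 = (k : ℤ) - 1 := by push_cast; omega
    have e4 : (((2 * k + 1 : ℕ) : ℤ)) / 2 = (k : ℤ) := by push_cast; omega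
    rw [e1, e2, e3, e4, hz]
    simp

theorem isLiftable_simpleReflection : C.IsLiftable C.simpleReflection := by
  intro s t
  have hss (s : B) : C.simpleReflection s * C.simpleReflection s = 1 :=
    LinearEquiv.ext fun v => Module.involutive_reflection (C.coroot_single_self s) v
  rcases eq_or_ne s t with rfl | hst
  · rw [hss, one_pow]
  rcases (by have := C.off_diagonal s t hst; omega : C s t = 0 ∨ C s t = 2 ∨ 3 ≤ C s t) with
    h | h | h
  · rw [h, pow_zero]
  · have hg : C.gramMatrix s t = 0 := by simp [gramMatrix, h]
    have hg' : C.gramMatrix t s = 0 := by rw [gramMatrix_comm, hg]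
    have hcomm : C.simpleReflection s * C.simpleReflection t =
        C.simpleReflection t * C.simpleReflection s := by
      refine LinearEquiv.ext fun v => ?_
      simp only [LinearEquiv.mul_apply, simpleReflection_apply, map_sub, map_smul,
        coroot_single, hg, hg']
      simp only [mul_zero, zero_smul, sub_zero]
      abel
    rw [h, pow_two, mul_assoc, ← mul_assoc (C.simpleReflection t), ← hcomm, mul_assoc, hss,
      mul_one, hss]
  · have ht : 2 * Real.cos (2 * Real.pi / (C s t : ℕ)) =
        C.coroot s (Finsupp.single t 1) * C.coroot t (Finsupp.single s 1) - 2 := by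
      have h0 : C s t ≠ 0 := by omega
      rw [coroot_single, coroot_single, gramMatrix_comm C t s]
      have : C.gramMatrix s t = -Real.cos (Real.pi / (C s t : ℝ)) := by simp [gramMatrix, h0]
      rw [this, mul_div_assoc, Real.cos_two_mul]
      ring
    obtain ⟨h1, h2⟩ := chebyshev_S_eval_eq_zero h
    refine LinearEquiv.ext fun v => ?_
    rw [simpleReflection, simpleReflection,
      Module.reflection_mul_reflection_pow_apply _ _ _ _ _ ht, h1, h2]
    simp

end CoxeterMatrix

namespace CoxeterSystem

variable {B : Type v} {C : CoxeterMatrix B} {W : Type u} [Group W] (cs : CoxeterSystem C W)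

/-- The geometric representation of the Coxeter group on `ℝ^S`. -/
noncomputable def geometricRep : W →* ((B →₀ ℝ) ≃ₗ[ℝ] (B →₀ ℝ)) :=
  cs.lift ⟨C.simpleReflection, C.isLiftable_simpleReflection⟩

theorem geometricRep_simple (s : B) (v : B →₀ ℝ) :
    cs.geometricRep (cs.simple s) v = v - C.coroot s v • Finsupp.single s 1 := by
  rw [geometricRep, cs.lift_apply_simple, C.simpleReflection_apply]

theorem geometricRep_apply_of_mem_parabolic {J : Set B} {t : B} (ht : t ∉ J) {w : W}
    (hw : w ∈ cs.parabolic J) (v : B →₀ ℝ) : cs.geometricRep w v t = v t := by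
  induction hw using Subgroup.closure_induction generalizing v with
  | mem x hx =>
    obtain ⟨s, hs, rfl⟩ := hx
    have hst : s ≠ t := fun h => ht (h ▸ hs)
    rw [cs.geometricRep_simple]
    simp [hst]
  | one => simp
  | mul x y _ _ hx hy => rw [map_mul, LinearEquiv.mul_apply, hx, hy]
  | inv x _ hx =>
    rw [← hx (cs.geometricRep x⁻¹ v), ← LinearEquiv.mul_apply, ← map_mul]
    simp

theorem simple_mem_parabolic {J : Set B} {t : B} (ht : t ∈ J) :
    cs.simple t ∈ cs.parabolic J :=
  Subgroup.subset_closure ⟨t, ht, rfl⟩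

theorem simple_mem_parabolic_iff {J : Set B} {t : B} :
    cs.simple t ∈ cs.parabolic J ↔ t ∈ J := by
  refine ⟨fun h => ?_, cs.simple_mem_parabolic⟩
  by_contra ht
  have h1 := cs.geometricRep_apply_of_mem_parabolic ht h (Finsupp.single t 1)
  rw [cs.geometricRep_simple, C.coroot_single_self] at h1
  norm_num at h1

/-- The coefficient of `e_t` in the image of `e_t` under `t r t` is `1 - 4 B(e_t, e_r) ^ 2`. -/
theorem eq_two_of_conj_mem_parabolic {J : Set B} {t r : B} (ht : t ∉ J) (hr : r ≠ t)
    (h : cs.simple t * cs.simple r * cs.simple t ∈ cs.parabolic J) : C r t = 2 := by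
  have h1 := cs.geometricRep_apply_of_mem_parabolic ht h (Finsupp.single t 1)
  simp only [map_mul, LinearEquiv.mul_apply, cs.geometricRep_simple, map_sub, map_smul,
    C.coroot_single, C.gramMatrix_self, C.gramMatrix_comm t r] at h1
  simp [hr] at h1
  refine C.eq_two_of_gramMatrix_eq_zero ?_
  nlinarith

/-- The geometric representation of a finite Coxeter group preserves an inner product, obtained by
averaging. -/
theorem exists_invariant_form [Finite W] :
    ∃ b : (B →₀ ℝ) →ₗ[ℝ] (B →₀ ℝ) →ₗ[ℝ] ℝ,
      (∀ w x y, b (cs.geometricRep w x) (cs.geometricRep w y) = b x y) ∧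
      (∀ x y, b x y = b y x) ∧ ∀ x, x ≠ 0 → 0 < b x x := by
  have : Fintype W := Fintype.ofFinite W
  let d : (B →₀ ℝ) →ₗ[ℝ] (B →₀ ℝ) →ₗ[ℝ] ℝ :=
    Finsupp.linearCombination ℝ fun i => Finsupp.lapply i
  have hd (x y : B →₀ ℝ) : d x y = x.sum fun i a => a * y i := by
    simp [d, Finsupp.linearCombination_apply, Finsupp.sum]
  have hcomm (x y : B →₀ ℝ) : d x y = d y x := by
    classical
    rw [hd, hd, Finsupp.sum_of_support_subset x (Finset.subset_union_left (s₂ := y.support)) _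
      (by simp), Finsupp.sum_of_support_subset y (Finset.subset_union_right (s₁ := x.support)) _
      (by simp)]
    exact Finset.sum_congr rfl fun i _ => mul_comm _ _
  have hpos (x : B →₀ ℝ) (hx : x ≠ 0) : 0 < d x x := by
    rw [hd]
    refine Finset.sum_pos (fun i hi => ?_) (Finsupp.support_nonempty_iff.mpr hx)
    exact mul_self_pos.mpr (Finsupp.mem_support_iff.mp hi)
  refine ⟨∑ g : W, d.compl₁₂ (cs.geometricRep g).toLinearMap (cs.geometricRep g).toLinearMap,
    fun w x y => ?_, fun x y => ?_, fun x hx => ?_⟩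
  · simp only [LinearMap.sum_apply, LinearMap.compl₁₂_apply, LinearEquiv.coe_coe]
    refine Fintype.sum_equiv (Equiv.mulRight w) _ _ fun g => ?_
    simp
  · simp only [LinearMap.sum_apply, LinearMap.compl₁₂_apply, LinearEquiv.coe_coe]
    exact Finset.sum_congr rfl fun g _ => hcomm _ _
  · simp only [LinearMap.sum_apply, LinearMap.compl₁₂_apply, LinearEquiv.coe_coe]
    exact Finset.sum_pos (fun g _ => hpos _ (by simpa using hx)) Finset.univ_nonempty

/-- The Coxeter diagram of a finite Coxeter group is definite: an invariant inner product `b`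
satisfies `b(e_s, e_t) = b(e_s, e_s) B(e_s, e_t)`, and by symmetry `b(e_s, e_s)` is constant on
connected components of the diagram, so that `b` and `B` agree after rescaling the basis. -/
theorem isDefinite_of_finite (cs : CoxeterSystem C W) [Finite W] : C.IsDefinite := by
  obtain ⟨b, hinv, hcomm, hpos⟩ := cs.exists_invariant_form
  let c : B → ℝ := fun s => b (Finsupp.single s 1) (Finsupp.single s 1)
  have hc (s : B) : 0 < c s := hpos _ (by simp)
  have hb (s t : B) : b (Finsupp.single s 1) (Finsupp.single t 1) = c s * C.gramMatrix s t := by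
    have h := hinv (cs.simple s) (Finsupp.single s 1) (Finsupp.single t 1)
    rw [cs.geometricRep_simple, cs.geometricRep_simple, C.coroot_single_self,
      C.coroot_single] at h
    simp only [map_sub, map_smul, LinearMap.sub_apply, LinearMap.smul_apply, smul_eq_mul] at h
    simp only [c]
    linarith
  have hB (s t : B) : C.gramMatrix s t =
      b (Finsupp.single s 1) (Finsupp.single t 1) / (√(c s) * √(c t)) := by
    have h1 := hb s t
    have h2 := hb t s
    rw [hcomm, h1, C.gramMatrix_comm t s] at h2
    by_cases h0 : C.gramMatrix s t = 0
    · rw [h1, h0]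
      simp
    · rw [h1, ← mul_right_cancel₀ h0 h2, Real.mul_self_sqrt (hc s).le,
        mul_div_cancel_left₀ _ (hc s).ne']
  refine ⟨?_, fun x hx => ?_⟩
  · ext s t
    simp [C.gramMatrix_comm t s]
  let y : B →₀ ℝ := x.sum fun s a => Finsupp.single s (a / √(c s))
  have hy (s : B) : y s = x s / √(c s) := by
    classical
    simp only [y, Finsupp.sum, Finsupp.finsetSum_apply, Finsupp.single_apply]
    simp +contextual
  have hy0 : y ≠ 0 := by
    obtain ⟨s, hs⟩ := Finsupp.ne_iff.mp hx
    refine Finsupp.ne_iff.mpr ⟨s, ?_⟩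
    rw [hy]
    exact div_ne_zero hs (Real.sqrt_pos.mpr (hc s)).ne'
  have hsingle (s : B) (a : ℝ) : Finsupp.single s a = a • Finsupp.single s (1 : ℝ) := by simp
  convert! hpos y hy0 using 1
  simp only [y, Finsupp.sum, map_sum, LinearMap.sum_apply]
  rw [Finset.sum_comm]
  refine Finset.sum_congr rfl fun s _ => Finset.sum_congr rfl fun t _ => ?_
  rw [hsingle s (x s / _), hsingle t (x t / _), hB]
  simp only [map_smul, LinearMap.smul_apply, smul_eq_mul, star_trivial]
  rw [hcomm (Finsupp.single t 1)]
  field_simp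

end CoxeterSystem

/-! ### The exchange condition -/

namespace CoxeterSystem

section Exchange

variable {B : Type v} {C : CoxeterMatrix B} {W : Type u} [Group W] (cs : CoxeterSystem C W)

open Classical in
/-- The permutation `(t, ε) ↦ (s t s, ε + [t = s])` of `W × ℤ/2`. Its restriction to reflections
is the action of `s` on signed reflections. -/
noncomputable def signedConj (i : B) : Function.End (W × ZMod 2) := fun p =>
  (cs.simple i * p.1 * cs.simple i, p.2 + if p.1 = cs.simple i then 1 else 0)

open Classical in
/-- A word acts by conjugation on the first component and counts the occurrences of the argument in
its inversion sequence on the second. -/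
theorem prod_map_signedConj (ω : List B) (p : W × ZMod 2) :
    (ω.map cs.signedConj).prod p =
      (cs.wordProd ω * p.1 * (cs.wordProd ω)⁻¹, p.2 + ((cs.rightInvSeq ω).count p.1 : ZMod 2)) := by
  induction ω with
  | nil =>
    change p = _
    simp
  | cons i ω ih =>
    rw [List.map_cons, List.prod_cons]
    change cs.signedConj i ((ω.map cs.signedConj).prod p) = _
    rw [ih]
    have hiff : cs.wordProd ω * p.1 * (cs.wordProd ω)⁻¹ = cs.simple i ↔
        (cs.wordProd ω)⁻¹ * cs.simple i * cs.wordProd ω = p.1 := by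
      constructor <;> intro h
      · rw [← h]; group
      · rw [← h]; group
    rw [rightInvSeq, List.count_cons, signedConj, cs.wordProd_cons]
    refine Prod.ext ?_ ?_
    · simp [mul_assoc]
    · simp only [hiff, beq_iff_eq]
      push_cast
      ring

theorem prod_map_alternatingWord {G : Type*} [Monoid G] (f : B → G) (i j : B) (m : ℕ) :
    ((alternatingWord i j (2 * m)).map f).prod = (f i * f j) ^ m := by
  induction m with
  | zero => simp [alternatingWord]
  | succ m ih =>
    rw [show 2 * (m + 1) = 2 * m + 1 + 1 from rfl, alternatingWord_succ', alternatingWord_succ']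
    simp [ih, pow_succ', mul_assoc]

theorem alternatingWord_two_mul_eq_reverse (i j : B) (m : ℕ) :
    alternatingWord i j (2 * m) = (alternatingWord j i (2 * m)).reverse := by
  induction m with
  | zero => simp [alternatingWord]
  | succ m ih =>
    rw [show 2 * (m + 1) = 2 * m + 1 + 1 from rfl, alternatingWord_succ', alternatingWord_succ',
      alternatingWord_succ, alternatingWord_succ, ih]
    simp

/-- The inversion sequence of the word of length `2 m` alternating between `i` and `j` runs twice
through the same `m` reflections. -/
theorem even_count_rightInvSeq_alternatingWord [DecidableEq W] (i j : B) (t : W) :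
    Even ((cs.rightInvSeq (alternatingWord i j (2 * C i j))).count t) := by
  rw [alternatingWord_two_mul_eq_reverse, rightInvSeq_reverse, List.count_reverse]
  set m := C i j with hm
  set L := cs.leftInvSeq (alternatingWord j i (2 * m)) with hL
  have hlen : L.length = 2 * m := by simp [hL]
  have hperiod : L.drop m = L.take m := by
    refine List.ext_getElem (by simp [hlen]; omega) fun k h1 h2 => ?_
    have hk : k < m := by simp [hlen] at h2; omega
    rw [List.getElem_drop, List.getElem_take]
    simp only [hL]
    rw [cs.getElem_leftInvSeq_alternatingWord j i m (m + k) (by omega),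
      cs.getElem_leftInvSeq_alternatingWord j i m k (by omega),
      prod_alternatingWord_eq_mul_pow, prod_alternatingWord_eq_mul_pow,
      show (2 * (m + k) + 1) / 2 = m + k by omega, show (2 * k + 1) / 2 = k by omega, pow_add,
      hm, cs.simple_mul_simple_pow]
    simp [parity_simps]
  rw [← List.take_append_drop m L, List.count_append, hperiod]
  exact ⟨_, rfl⟩

theorem isLiftable_signedConj : C.IsLiftable cs.signedConj := by
  classical
  intro i j
  rw [← prod_map_alternatingWord]
  funext p
  rw [prod_map_signedConj]
  have h1 : cs.wordProd (alternatingWord i j (2 * C i j)) = 1 := by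
    rw [prod_alternatingWord_eq_mul_pow]
    simp
  have h2 : (((cs.rightInvSeq (alternatingWord i j (2 * C i j))).count p.1 : ℕ) : ZMod 2) = 0 :=
    (ZMod.natCast_eq_zero_iff_even).mpr (cs.even_count_rightInvSeq_alternatingWord i j p.1)
  rw [h1, h2]
  simp [Function.End.one_def]

/-- The parity of the number of occurrences of `t` in the inversion sequence of a word depends only
on the product of the word. -/
theorem count_rightInvSeq_congr [DecidableEq W] {ω ω' : List B}
    (h : cs.wordProd ω = cs.wordProd ω') (t : W) :
    (((cs.rightInvSeq ω).count t : ℕ) : ZMod 2) = ((cs.rightInvSeq ω').count t : ℕ) := by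
  classical
  have key (ω : List B) : cs.lift ⟨cs.signedConj, cs.isLiftable_signedConj⟩ (cs.wordProd ω) =
      (ω.map cs.signedConj).prod := by
    rw [wordProd, map_list_prod, List.map_map]
    congr 2
    funext i
    exact cs.lift_apply_simple cs.isLiftable_signedConj i
  have h1 := congrFun (key ω) (t, 0)
  have h2 := congrFun (key ω') (t, 0)
  rw [prod_map_signedConj] at h1 h2
  rw [h] at h1
  have h3 := congrArg Prod.snd (h1.symm.trans h2)
  simp only [zero_add] at h3
  convert h3

/-- The reflection `s_i` occurs exactly once in the inversion sequence of the word obtained by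
appending `i` to a reduced word of the shorter element, hence an odd number of times in that
of `ω`. -/
theorem mem_rightInvSeq_of_length_mul_simple_lt {ω : List B} {i : B}
    (h : cs.length (cs.wordProd ω * cs.simple i) < cs.length (cs.wordProd ω)) :
    cs.simple i ∈ cs.rightInvSeq ω := by
  classical
  obtain ⟨ω₁, hred, hω₁⟩ := cs.exists_isReduced (cs.wordProd ω * cs.simple i)
  have hw : cs.wordProd ω = cs.wordProd (ω₁.concat i) := by
    rw [cs.wordProd_concat, ← hω₁]
    simp
  -- The reflection does not occur in the inversion sequence of the shorter element.
  have hnot : cs.simple i ∉ cs.rightInvSeq ω₁ := fun hmem => by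
    have := (cs.isRightInversion_of_mem_rightInvSeq hred hmem).2
    rw [← hω₁] at this
    simp only [simple_mul_simple_cancel_right] at this
    omega
  have hcount := cs.count_rightInvSeq_congr hw (cs.simple i)
  have hone : (cs.rightInvSeq (ω₁.concat i)).count (cs.simple i) = 1 := by
    rw [rightInvSeq_concat, List.concat_eq_append, List.count_append]
    have hz : ((cs.rightInvSeq ω₁).map (MulAut.conj (cs.simple i))).count (cs.simple i) = 0 := by
      rw [List.count_eq_zero]
      intro hmem
      obtain ⟨x, hx, hxi⟩ := List.mem_map.mp hmem
      apply hnot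
      have : x = cs.simple i := by
        rw [MulAut.conj_apply] at hxi
        have := congrArg (fun y => (cs.simple i)⁻¹ * y * cs.simple i) hxi
        simpa [mul_assoc] using this
      rwa [← this]
    rw [hz]
    simp
  rw [hone] at hcount
  by_contra hcon
  rw [List.count_eq_zero_of_not_mem hcon] at hcount
  simp at hcount

/-- The exchange condition: if `s_i` is a left descent of the product of a word, then multiplying by
`s_i` amounts to deleting a letter. -/
theorem exists_eraseIdx_of_isLeftDescent {ω : List B} {i : B}
    (h : cs.length (cs.simple i * cs.wordProd ω) < cs.length (cs.wordProd ω)) :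
    ∃ j < ω.length, cs.simple i * cs.wordProd ω = cs.wordProd (ω.eraseIdx j) := by
  have hmem : cs.simple i ∈ cs.rightInvSeq ω.reverse := by
    apply cs.mem_rightInvSeq_of_length_mul_simple_lt
    rw [wordProd_reverse, ← cs.length_inv (cs.wordProd ω)⁻¹, ← cs.length_inv (_ * _)]
    simpa using h
  rw [rightInvSeq_reverse, List.mem_reverse] at hmem
  obtain ⟨j, hj, hji⟩ := List.mem_iff_getElem.mp hmem
  refine ⟨j, by simpa using hj, ?_⟩
  rw [← cs.getD_leftInvSeq_mul_wordProd, List.getD_eq_getElem _ _ hj, hji]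

end Exchange

/-! ### Supports and parabolic subgroups -/

section Parabolic

variable {B : Type v} {C : CoxeterMatrix B} {W : Type u} [Group W] (cs : CoxeterSystem C W)

theorem parabolic_mono {J K : Set B} (h : J ⊆ K) : cs.parabolic J ≤ cs.parabolic K :=
  Subgroup.closure_mono (Set.image_mono h)

theorem wordProd_mem_parabolic {J : Set B} {ω : List B} (h : ∀ i ∈ ω, i ∈ J) :
    cs.wordProd ω ∈ cs.parabolic J := by
  refine Subgroup.list_prod_mem _ fun x hx => ?_
  obtain ⟨i, hi, rfl⟩ := List.mem_map.mp hx
  exact cs.simple_mem_parabolic (h i hi)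

theorem exists_word_of_mem_parabolic {J : Set B} {w : W} (hw : w ∈ cs.parabolic J) :
    ∃ ω : List B, (∀ i ∈ ω, i ∈ J) ∧ w = cs.wordProd ω := by
  induction hw using Subgroup.closure_induction with
  | mem x hx =>
    obtain ⟨s, hs, rfl⟩ := hx
    exact ⟨[s], by simpa using hs, by simp⟩
  | one => exact ⟨[], by simp, by simp⟩
  | mul x y _ _ hx hy =>
    obtain ⟨ω, hω, rfl⟩ := hx
    obtain ⟨ω', hω', rfl⟩ := hy
    refine ⟨ω ++ ω', fun i hi => ?_, by rw [cs.wordProd_append]⟩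
    rcases List.mem_append.mp hi with h | h
    exacts [hω i h, hω' i h]
  | inv x _ hx =>
    obtain ⟨ω, hω, rfl⟩ := hx
    exact ⟨ω.reverse, fun i hi => hω i (List.mem_reverse.mp hi), by rw [cs.wordProd_reverse]⟩

theorem IsReduced.tail {cs : CoxeterSystem C W} {i : B} {ω : List B}
    (h : cs.IsReduced (i :: ω)) : cs.IsReduced ω := by
  simpa using h.drop 1

theorem IsReduced.length_simple_mul_lt {cs : CoxeterSystem C W} {i : B} {ω : List B}
    (h : cs.IsReduced (i :: ω)) :
    cs.length (cs.simple i * cs.wordProd (i :: ω)) < cs.length (cs.wordProd (i :: ω)) := by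
  rw [h.eq, cs.wordProd_cons, simple_mul_simple_cancel_left, h.tail.eq]
  simp

/-- All letters of a reduced word of an element of `W_J` lie in `J`. -/
theorem IsReduced.mem_of_wordProd_mem_parabolic {cs : CoxeterSystem C W} {J : Set B} {ω : List B}
    (hω : cs.IsReduced ω) (h : cs.wordProd ω ∈ cs.parabolic J) : ∀ i ∈ ω, i ∈ J := by
  induction ω with
  | nil => simp
  | cons s ω ih =>
    have hlt := hω.length_simple_mul_lt
    obtain ⟨ω₁, hω₁, he⟩ := cs.exists_word_of_mem_parabolic h
    rw [he] at hlt
    obtain ⟨j, _, hj⟩ := cs.exists_eraseIdx_of_isLeftDescent hlt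
    have hmem : cs.simple s * cs.wordProd (s :: ω) ∈ cs.parabolic J := by
      rw [he, hj]
      exact cs.wordProd_mem_parabolic fun i hi => hω₁ i (List.mem_of_mem_eraseIdx hi)
    have htail : cs.wordProd ω ∈ cs.parabolic J := by
      rwa [cs.wordProd_cons, simple_mul_simple_cancel_left] at hmem
    have hs : cs.simple s ∈ cs.parabolic J := by
      rw [cs.wordProd_cons] at h
      exact (Subgroup.mul_mem_cancel_right _ htail).mp h
    rw [List.forall_mem_cons]
    exact ⟨cs.simple_mem_parabolic_iff.mp hs, ih hω.tail htail⟩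

theorem length_simple_mul_of_mem_parabolic {t : B} {g : W}
    (hg : g ∈ cs.parabolic {t}ᶜ) : cs.length (cs.simple t * g) = cs.length g + 1 := by
  refine (cs.length_simple_mul g t).resolve_right fun h => ?_
  obtain ⟨ω, hω, rfl⟩ := cs.exists_word_of_mem_parabolic hg
  obtain ⟨j, _, hj⟩ := cs.exists_eraseIdx_of_isLeftDescent (ω := ω) (i := t) (by omega)
  have hmem : cs.simple t * cs.wordProd ω ∈ cs.parabolic {t}ᶜ := by
    rw [hj]
    exact cs.wordProd_mem_parabolic fun i hi => hω i (List.mem_of_mem_eraseIdx hi)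
  exact cs.simple_mem_parabolic_iff.mp ((Subgroup.mul_mem_cancel_right _ hg).mp hmem) rfl

theorem length_mul_simple_of_mem_parabolic {t : B} {g : W}
    (hg : g ∈ cs.parabolic {t}ᶜ) : cs.length (g * cs.simple t) = cs.length g + 1 := by
  rw [← cs.length_inv, mul_inv_rev, cs.inv_simple,
    cs.length_simple_mul_of_mem_parabolic (inv_mem hg), cs.length_inv]

/-- If `t` does not occur in `h` and does not occur in `t h t` either, then each letter of a reduced
word of `h` commutes with `t`. -/
theorem IsReduced.eq_two_of_conj_mem_parabolic {cs : CoxeterSystem C W} {t : B} {ω : List B}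
    (hω : cs.IsReduced ω) (h : cs.wordProd ω ∈ cs.parabolic {t}ᶜ)
    (ht : cs.simple t * cs.wordProd ω * cs.simple t ∈ cs.parabolic {t}ᶜ) :
    ∀ r ∈ ω, C r t = 2 := by
  induction ω with
  | nil => simp
  | cons r ω ih =>
    have hrt : r ∈ ({t}ᶜ : Set B) := hω.mem_of_wordProd_mem_parabolic h r (by simp)
    have hrmem : cs.simple r ∈ cs.parabolic {t}ᶜ := cs.simple_mem_parabolic hrt
    obtain ⟨ω₁, hω₁, he⟩ := cs.exists_word_of_mem_parabolic ht
    have hcons : cs.wordProd (r :: ω) * cs.simple t = cs.wordProd (t :: ω₁) := by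
      rw [cs.wordProd_cons t, ← he, mul_assoc, simple_mul_simple_cancel_left]
    -- `r` is a left descent of `h t = t g`, where `g = t h t`; the letter that the exchange
    -- condition deletes from `t g` lies in `g`.
    have hlt : cs.length (cs.simple r * cs.wordProd (t :: ω₁)) <
        cs.length (cs.wordProd (t :: ω₁)) := by
      rw [← hcons, cs.length_mul_simple_of_mem_parabolic h, hω.eq, cs.wordProd_cons, ← mul_assoc,
        simple_mul_simple_cancel_left]
      have h1 := cs.length_mul_le (cs.wordProd ω) (cs.simple t)
      rw [cs.length_simple, hω.tail.eq] at h1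
      simp only [List.length_cons]
      omega
    obtain ⟨j, _, hj⟩ := cs.exists_eraseIdx_of_isLeftDescent hlt
    have hconj : cs.simple t * cs.simple r * cs.simple t ∈ cs.parabolic {t}ᶜ := by
      have hg₁ : cs.wordProd ω₁ ∈ cs.parabolic {t}ᶜ := cs.wordProd_mem_parabolic hω₁
      cases j with
      | zero =>
        rw [List.eraseIdx_cons_zero, cs.wordProd_cons, ← mul_assoc] at hj
        have h1 : cs.simple r * cs.simple t = 1 := by simpa using hj
        rw [mul_assoc, h1, mul_one]
        rw [mul_eq_one_iff_eq_inv, cs.inv_simple] at h1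
        rwa [← h1]
      | succ j =>
        rw [List.eraseIdx_cons_succ, cs.wordProd_cons, cs.wordProd_cons, ← mul_assoc] at hj
        have h2 : cs.wordProd (ω₁.eraseIdx j) ∈ cs.parabolic {t}ᶜ :=
          cs.wordProd_mem_parabolic fun i hi => hω₁ i (List.mem_of_mem_eraseIdx hi)
        refine (Subgroup.mul_mem_cancel_right _ hg₁).mp ?_
        rw [mul_assoc (cs.simple t), mul_assoc (cs.simple t), hj, simple_mul_simple_cancel_left]
        exact h2
    have htwo : C r t = 2 := cs.eq_two_of_conj_mem_parabolic (by simp) (by simpa using hrt) hconj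
    have hcomm : cs.simple t * cs.simple r = cs.simple r * cs.simple t := by
      have h1 := cs.simple_mul_simple_pow r t
      rw [htwo, pow_two, mul_eq_one_iff_eq_inv, mul_inv_rev, cs.inv_simple, cs.inv_simple] at h1
      exact h1.symm
    have htail : cs.wordProd ω ∈ cs.parabolic {t}ᶜ := by
      rw [cs.wordProd_cons] at h
      exact (Subgroup.mul_mem_cancel_left _ hrmem).mp h
    rw [List.forall_mem_cons]
    refine ⟨htwo, ih hω.tail htail ?_⟩
    rw [cs.wordProd_cons, ← mul_assoc, hcomm, mul_assoc, mul_assoc] at ht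
    rw [mul_assoc]
    exact (Subgroup.mul_mem_cancel_left _ hrmem).mp ht

/-- If neither `g` nor `t g t` involves `t`, then `g` involves no neighbour of `t` in the diagram. -/
theorem mem_parabolic_compl_of_adj {t j : B} (hadj : C.diagram.Adj t j) {g : W}
    (hg : g ∈ cs.parabolic {t}ᶜ)
    (ht : cs.simple t * g * cs.simple t ∈ cs.parabolic {t}ᶜ) : g ∈ cs.parabolic {j}ᶜ := by
  obtain ⟨ω, hω, rfl⟩ := cs.exists_isReduced g
  refine cs.wordProd_mem_parabolic fun r hr => ?_
  rintro rfl
  exact hadj.2 (by rw [C.symmetric t r]; exact hω.eq_two_of_conj_mem_parabolic hg ht r hr)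

theorem mem_parabolic_compl {J : Set B} {g : W} (h : ∀ j ∈ J, g ∈ cs.parabolic {j}ᶜ) :
    g ∈ cs.parabolic Jᶜ := by
  obtain ⟨ω, hω, rfl⟩ := cs.exists_isReduced g
  exact cs.wordProd_mem_parabolic fun r hr hrJ =>
    hω.mem_of_wordProd_mem_parabolic (h r hrJ) r hr rfl

end Parabolic

/-! ### Vertex stabilisers -/

section Stabiliser

variable {B : Type v} {C : CoxeterMatrix B} {W : Type u} [Group W] (cs : CoxeterSystem C W)

/-- The elements of the vertex stabiliser that fix all neighbours of the standard vertex. -/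
def neighbourFixer (M : Set B) : Set W :=
  {g | g ∈ cs.parabolic Mᶜ ∧ ∀ p ∈ cs.parabolic Mᶜ, ∀ s ∈ M,
    g • p • cs.simple s • cs.baseVertex M = p • cs.simple s • cs.baseVertex M}

theorem smul_baseVertex_eq_iff (M : Set B) (g h : W) :
    g • cs.baseVertex M = h • cs.baseVertex M ↔ g⁻¹ * h ∈ cs.parabolic Mᶜ := by
  simp only [baseVertex, MulAction.Quotient.smul_mk, smul_eq_mul, mul_one]
  exact QuotientGroup.eq

/-- A node `r` in the component of an element of `M` occurs in no element of the
`neighbourFixer`: going along a path of the diagram, conjugation by the node `t` before `r` keeps the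
fixer inside the stabiliser. -/
theorem mem_parabolic_of_mem_neighbourFixer {M : Set B} {s r : B} (hs : s ∈ M)
    (h : C.diagram.Reachable s r) {g : W} (hg : g ∈ cs.neighbourFixer M) :
    g ∈ cs.parabolic {r}ᶜ := by
  rw [SimpleGraph.reachable_iff_reflTransGen] at h
  induction h generalizing g with
  | refl => exact cs.parabolic_mono (by simpa using hs) hg.1
  | @tail t j _ hadj ih =>
    refine cs.mem_parabolic_compl_of_adj hadj (ih hg) ?_
    by_cases ht : t ∈ M
    · refine cs.parabolic_mono (J := Mᶜ) (by simpa using ht) ?_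
      have h1 := hg.2 1 (one_mem _) t ht
      rw [one_smul, smul_smul, eq_comm, smul_baseVertex_eq_iff, cs.inv_simple] at h1
      rwa [mul_assoc]
    · refine ih ⟨?_, fun p hp s hs => ?_⟩
      · have htmem : cs.simple t ∈ cs.parabolic Mᶜ := cs.simple_mem_parabolic ht
        exact mul_mem (mul_mem htmem hg.1) htmem
      · have htmem : cs.simple t ∈ cs.parabolic Mᶜ := cs.simple_mem_parabolic ht
        have h1 := hg.2 (cs.simple t * p) (mul_mem htmem hp) s hs
        have h2 := congrArg (cs.simple t • ·) h1
        simpa [smul_smul, mul_assoc] using h2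

theorem neighbourFixer_subset (M : Set B) :
    cs.neighbourFixer M ⊆ cs.parabolic (C.unreachedNodes M) := by
  intro g hg
  have h := cs.mem_parabolic_compl (J := (C.unreachedNodes M)ᶜ) (g := g) fun j hj => by
    simp only [CoxeterMatrix.unreachedNodes, Set.mem_compl_iff, Set.mem_ofPred_eq, not_forall,
      not_not] at hj
    obtain ⟨s, hs, hjs⟩ := hj
    exact cs.mem_parabolic_of_mem_neighbourFixer hs hjs.symm hg
  rwa [compl_compl] at h


end Stabiliser

end CoxeterSystem

namespace CoxeterSystem

section StabiliserFinite

variable {B : Type v} {C : CoxeterMatrix B} {W : Type u} [Group W] (cs : CoxeterSystem C W)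

theorem smul_baseVertex_of_mem {M : Set B} {p : W} (hp : p ∈ cs.parabolic Mᶜ) :
    p • cs.baseVertex M = cs.baseVertex M := by
  have := (cs.smul_baseVertex_eq_iff M p 1).mpr (by simpa using hp)
  simpa using this

theorem standardFace_singleton (M : Set B) (s : B) :
    cs.standardFace M {s} = {cs.baseVertex M, cs.simple s • cs.baseVertex M} := by
  have key (w : W) (hw : w ∈ cs.parabolic {s}) : w = 1 ∨ w = cs.simple s := by
    induction hw using Subgroup.closure_induction with
    | mem x hx => simpa using Or.inr hx
    | one => simp
    | mul x y _ _ hx hy => rcases hx with rfl | rfl <;> rcases hy with rfl | rfl <;> simp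
    | inv x _ hx => rcases hx with rfl | rfl <;> simp
  ext x
  constructor
  · rintro ⟨w, hw, rfl⟩
    rcases key w hw with rfl | rfl <;> simp
  · rintro (rfl | rfl)
    · exact ⟨1, one_mem _, by simp⟩
    · exact ⟨_, cs.simple_mem_parabolic rfl, rfl⟩

/-- The vertices joined to the standard vertex by an edge. -/
def baseNeighbours (M : Set B) : Set (cs.WythoffVertex M) :=
  {y | ∃ p ∈ cs.parabolic Mᶜ, ∃ s ∈ M, y = p • cs.simple s • cs.baseVertex M}

theorem finite_baseNeighbours {M : Set B} (hlink : cs.HasFiniteVertexLinks M) :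
    (cs.baseNeighbours M).Finite := by
  have hfin := (hlink (cs.baseVertex M)).subset
    (Set.sep_subset _ fun F => (F.1 : Set (cs.WythoffVertex M)).Finite)
  refine (hfin.biUnion fun F hF => hF.2).subset ?_
  rintro _ ⟨p, hp, s, -, rfl⟩
  have hface : p • cs.standardFace M {s} =
      {cs.baseVertex M, p • cs.simple s • cs.baseVertex M} := by
    rw [standardFace_singleton, Set.smul_set_insert, Set.smul_set_singleton,
      cs.smul_baseVertex_of_mem hp]
  refine Set.mem_biUnion (x := ⟨p • cs.standardFace M {s}, Or.inr ⟨p, {s}, rfl⟩⟩)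
    ⟨⟨?_, fun _ _ => trivial⟩, ?_⟩ ?_
  · change {cs.baseVertex M} ⊆ p • cs.standardFace M {s}
    simp [hface]
  · change (p • cs.standardFace M {s}).Finite
    rw [hface]
    exact Set.toFinite _
  · change _ ∈ p • cs.standardFace M {s}
    simp [hface]

/-- If the vertex links are finite, then so is the vertex stabiliser, since the elements fixing all
neighbours of the standard vertex have finite index in it and form a finite group. -/
theorem finite_parabolic_compl {M : Set B} (hM : Finite (cs.parabolic (C.unreachedNodes M)))
    (hlink : cs.HasFiniteVertexLinks M) : (cs.parabolic Mᶜ : Set W).Finite := by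
  have hY := cs.finite_baseNeighbours hlink
  have := hY.to_subtype
  have hQ : (cs.neighbourFixer M).Finite :=
    Set.Finite.subset (Set.toFinite (cs.parabolic (C.unreachedNodes M) : Set W))
      (cs.neighbourFixer_subset M)
  refine Set.Finite.of_finite_fibers
    (fun (g : W) (y : cs.baseNeighbours M) => g • (y : cs.WythoffVertex M)) ?_ ?_
  · refine (Set.Finite.pi' fun _ => hY).subset ?_
    rintro _ ⟨g, hg, rfl⟩ ⟨_, p, hp, s, hs, rfl⟩
    exact ⟨g * p, mul_mem hg hp, s, hs, by simp [mul_smul]⟩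
  · rintro _ ⟨g₀, hg₀, rfl⟩
    refine (hQ.image (g₀ * ·)).subset ?_
    rintro g ⟨hg, hgg⟩
    refine ⟨g₀⁻¹ * g, ⟨mul_mem (inv_mem hg₀) hg, fun p hp s hs => ?_⟩, by simp⟩
    have h := congrFun hgg ⟨_, p, hp, s, hs, rfl⟩
    rw [mul_smul, inv_smul_eq_iff]
    exact h

theorem finite_setOf_smul_mem {M : Set B} (hP : (cs.parabolic Mᶜ : Set W).Finite)
    (x : cs.WythoffVertex M) {S : Set (cs.WythoffVertex M)} (hS : S.Finite) :
    {g : W | g • x ∈ S}.Finite := by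
  refine Set.Finite.preimage' (f := fun g : W => g • x) hS fun y _ => ?_
  obtain ⟨w, rfl⟩ := QuotientGroup.mk_surjective x
  obtain ⟨v, rfl⟩ := QuotientGroup.mk_surjective y
  refine (hP.image fun p => v * p * w⁻¹).subset fun g hg => ?_
  refine ⟨v⁻¹ * (g * w), ?_, by group⟩
  have h : (QuotientGroup.mk (g * w) : cs.WythoffVertex M) = QuotientGroup.mk v := hg
  exact QuotientGroup.eq.mp h.symm

theorem smul_wythoffSkeleton_adj {M : Set B} (g : W) {x y : cs.WythoffVertex M}
    (h : (cs.wythoffSkeleton M).Adj x y) : (cs.wythoffSkeleton M).Adj (g • x) (g • y) := by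
  obtain ⟨hne, w, s, hs, rfl, rfl⟩ := h
  exact ⟨fun h => hne (smul_left_cancel g h), g * w, s, hs, by simp [mul_smul], by simp [mul_smul]⟩

theorem finite_neighborSet {M : Set B} (hlink : cs.HasFiniteVertexLinks M)
    (x : cs.WythoffVertex M) : ((cs.wythoffSkeleton M).neighborSet x).Finite := by
  obtain ⟨g, rfl⟩ := QuotientGroup.mk_surjective x
  refine ((cs.finite_baseNeighbours hlink).image (g • ·)).subset ?_
  rintro _ ⟨-, w, s, hs, hx, rfl⟩
  refine ⟨(g⁻¹ * w) • cs.simple s • cs.baseVertex M, ⟨g⁻¹ * w, ?_, s, hs, rfl⟩, ?_⟩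
  · rw [← smul_baseVertex_eq_iff, ← hx]
    simp [baseVertex]
  · simp [mul_smul]

end StabiliserFinite

end CoxeterSystem

/-! ### Regularity of orbit graphs -/

theorem IsHighlyRegular.of_iso {l : List Cardinal.{u}} {V V' : Type u} {G : SimpleGraph V}
    {H : SimpleGraph V'} (e : G ≃g H) (h : IsHighlyRegular l G) : IsHighlyRegular l H := by
  induction l generalizing V V' with
  | nil => trivial
  | cons a l ih =>
    obtain ⟨⟨h1, h2⟩, h3⟩ := h
    refine ⟨⟨fun y => ?_, fun hV => h2 (e.toEquiv.isEmpty)⟩, fun y => ?_⟩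
    · rw [← h1 (e.symm y)]
      exact Cardinal.mk_congr (e.symm.mapNeighborSet y)
    · refine ih (e.induce (s := G.neighborSet (e.symm y)) ⟨fun x hx => ?_,
        e.injective.injOn, fun x hx => ⟨e.symm x, ?_, by simp⟩⟩) (h3 (e.symm y))
      · have := e.map_adj_iff.mpr hx
        simpa using this
      · exact e.symm.map_adj_iff.mpr hx

section OrbitGraph

variable {N : Type*} [Group N] {V : Type u} [MulAction N V] {G : SimpleGraph V}

/-- If no vertex is moved by `N` to a different vertex at distance at most `3`, then the
neighbourhood of a vertex maps isomorphically to that of its orbit. -/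
theorem nonempty_iso_orbitGraph_neighborSet
    (hadj : ∀ (n : N) (x y : V), G.Adj x y → G.Adj (n • x) (n • y))
    (hfree : ∀ (n : N) (x a b : V), (x = a ∨ G.Adj x a) → (a = b ∨ G.Adj a b) →
      (b = n • x ∨ G.Adj b (n • x)) → n • x = x) (x : V) :
    Nonempty (G.induce (G.neighborSet x) ≃g (orbitGraph N G).induce
      ((orbitGraph N G).neighborSet (Quotient.mk'' x))) := by
  have hmk (y z : V) : (Quotient.mk'' y : MulAction.orbitRel.Quotient N V) = Quotient.mk'' z ↔
      ∃ n : N, n • z = y := by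
    rw [Quotient.eq'']
    rfl
  have hinj (y z : V) (hy : G.Adj x y) (hz : G.Adj x z)
      (h : (Quotient.mk'' y : MulAction.orbitRel.Quotient N V) = Quotient.mk'' z) : y = z := by
    obtain ⟨n, rfl⟩ := (hmk _ _).mp h
    exact hfree n z x x (Or.inr hz.symm) (Or.inl rfl) (Or.inr hy)
  have hne (y z : V) (hyz : G.Adj y z) :
      (Quotient.mk'' y : MulAction.orbitRel.Quotient N V) ≠ Quotient.mk'' z := by
    intro h
    obtain ⟨n, rfl⟩ := (hmk _ _).mp h
    exact hyz.ne (hfree n z z z (Or.inl rfl) (Or.inl rfl) (Or.inr hyz.symm))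
  have hmap (y z : V) (hyz : G.Adj y z) :
      (orbitGraph N G).Adj (Quotient.mk'' y) (Quotient.mk'' z) :=
    ⟨hne y z hyz, y, z, rfl, rfl, hyz⟩
  have hsurj (q : MulAction.orbitRel.Quotient N V)
      (hq : (orbitGraph N G).Adj (Quotient.mk'' x) q) :
      ∃ y, G.Adj x y ∧ Quotient.mk'' y = q := by
    obtain ⟨-, x', y', hx', rfl, h⟩ := hq
    obtain ⟨n, rfl⟩ := (hmk _ _).mp hx'
    exact ⟨n • y', hadj n _ _ h, (hmk _ _).mpr ⟨n, rfl⟩⟩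
  refine ⟨{
    toEquiv := Equiv.ofBijective
      (fun y => ⟨Quotient.mk'' y.1, hmap x y.1 y.2⟩) ⟨?_, ?_⟩
    map_rel_iff' := ?_ }⟩
  · rintro ⟨y, hy⟩ ⟨z, hz⟩ h
    exact Subtype.ext (hinj y z hy hz (congrArg Subtype.val h))
  · rintro ⟨q, hq⟩
    obtain ⟨y, hy, rfl⟩ := hsurj q hq
    exact ⟨⟨y, hy⟩, rfl⟩
  · rintro ⟨y, hy⟩ ⟨z, hz⟩
    change (orbitGraph N G).Adj (Quotient.mk'' y) (Quotient.mk'' z) ↔ G.Adj y z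
    refine ⟨?_, hmap y z⟩
    rintro ⟨-, y', z', hy', hz', h⟩
    obtain ⟨m, rfl⟩ := (hmk _ _).mp hy'
    obtain ⟨n, rfl⟩ := (hmk _ _).mp hz'
    -- `m y'` and `n z'` are neighbours of `x`, and `m z'` is a neighbour of `m y'`; hence `m z'`
    -- has distance at most `3` from `n z'`.
    have h1 := hadj m _ _ h
    have h2 := hfree (m * n⁻¹) (n • z') x (m • y') (Or.inr hz.symm) (Or.inr hy)
      (Or.inr (by simpa [mul_smul] using h1))
    rw [mul_smul, inv_smul_smul] at h2
    rwa [h2] at h1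

theorem IsHighlyRegular.orbitGraph {l : List Cardinal.{u}} (hl : IsHighlyRegular l G)
    (hadj : ∀ (n : N) (x y : V), G.Adj x y → G.Adj (n • x) (n • y))
    (hfree : ∀ (n : N) (x a b : V), (x = a ∨ G.Adj x a) → (a = b ∨ G.Adj a b) →
      (b = n • x ∨ G.Adj b (n • x)) → n • x = x) :
    IsHighlyRegular l (orbitGraph N G) := by
  cases l with
  | nil => trivial
  | cons a l =>
    obtain ⟨⟨h1, h2⟩, h3⟩ := hl
    refine ⟨⟨fun q => ?_, fun hV => h2 ⟨fun x => hV.elim (Quotient.mk'' x)⟩⟩, fun q => ?_⟩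
    · induction q using Quotient.inductionOn' with
      | h x =>
        obtain ⟨e⟩ := nonempty_iso_orbitGraph_neighborSet hadj hfree x
        rw [← h1 x]
        exact Cardinal.mk_congr e.symm.toEquiv
    · induction q using Quotient.inductionOn' with
      | h x =>
        obtain ⟨e⟩ := nonempty_iso_orbitGraph_neighborSet hadj hfree x
        exact (h3 x).of_iso e

end OrbitGraph

/-! ### Separating finite sets by the family of subgroups -/

/-- A family with trivial intersection that is closed under pairwise intersection contains members
avoiding any given finite set of non-trivial elements. -/
theorem exists_forall_mem_imp_eq_one {W : Type*} [Group W] {I : Type*} [Nonempty I]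
    {N : I → Subgroup W} (hinter : ∀ m m', ∃ k, N k = N m ⊓ N m') (hbot : (⨅ m, N m) = ⊥)
    {F : Set W} (hF : F.Finite) : ∃ m, ∀ f ∈ F, f ∈ N m → f = 1 := by
  induction F, hF using Set.Finite.induction_on with
  | empty => exact ⟨Classical.arbitrary I, by simp⟩
  | @insert f F _ _ ih =>
    obtain ⟨m, hm⟩ := ih
    by_cases hf : f = 1
    · exact ⟨m, by rintro g (rfl | hg) h; exacts [hf, hm g hg h]⟩
    obtain ⟨m', hm'⟩ : ∃ m', f ∉ N m' := by
      by_contra! h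
      have : f ∈ ⨅ m, N m := Subgroup.mem_iInf.mpr h
      rw [hbot] at this
      exact hf (Subgroup.mem_bot.mp this)
    obtain ⟨k, hk⟩ := hinter m m'
    refine ⟨k, ?_⟩
    rw [hk]
    rintro g (rfl | hg) h
    exacts [absurd h.2 hm', hm g hg h.1]

/-- The orbits of a normal subgroup on a transitive `W`-set are the images of its cosets. -/
theorem finite_orbitRel_quotient_of_finiteIndex {W : Type*} [Group W] (N : Subgroup W) [N.Normal]
    [N.FiniteIndex] (V : Type*) [MulAction W V] [MulAction.IsPretransitive W V] :
    Finite (MulAction.orbitRel.Quotient N V) := by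
  rcases isEmpty_or_nonempty V with hV | ⟨⟨x₀⟩⟩
  · exact Quotient.finite _
  refine Finite.of_surjective (fun q : W ⧸ N => Quotient.liftOn' q
    (fun w => (Quotient.mk'' (w • x₀) : MulAction.orbitRel.Quotient N V)) ?_) ?_
  · intro g h hgh
    rw [QuotientGroup.leftRel_apply] at hgh
    refine Quotient.eq''.mpr ⟨⟨g * h⁻¹, ?_⟩, ?_⟩
    · have h1 := (inferInstance : N.Normal).conj_mem _ (inv_mem hgh) g
      simpa [mul_assoc] using h1
    · change (g * h⁻¹) • h • x₀ = g • x₀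
      rw [smul_smul, inv_mul_cancel_right]
  · intro q
    induction q using Quotient.inductionOn' with
    | h x =>
      obtain ⟨w, rfl⟩ := MulAction.exists_smul_eq W x₀ x
      exact ⟨QuotientGroup.mk w, rfl⟩

theorem mainTheorem7 {B : Type v} [Finite B] {C : CoxeterMatrix B} {W : Type u} [Group W]
    (cs : CoxeterSystem C W) (M : Set B)
    (hdef : ¬ C.IsDefinite)
    (hM : Finite (cs.parabolic (C.unreachedNodes M)))
    (hlink : cs.HasFiniteVertexLinks M)
    (a : List Cardinal.{u}) (hreg : IsHighlyRegular a (cs.wythoffSkeleton M))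
    {I : Type*} (N : I → Subgroup W)
    (hnormal : ∀ m, (N m).Normal) (hindex : ∀ m, (N m).FiniteIndex)
    (hinter : ∀ m m', ∃ k, N k = N m ⊓ N m')
    (hbot : (⨅ m, N m) = ⊥) :
    ∃ I' : Set I,
      (∀ m ∈ I', ∀ m' ∈ I', ∃ k ∈ I', N k = N m ⊓ N m') ∧
      (⨅ m ∈ I', N m) = ⊥ ∧
      (∀ m ∈ I', Finite (MulAction.orbitRel.Quotient (N m) (cs.WythoffVertex M)) ∧
        IsHighlyRegular a (orbitGraph (N m) (cs.wythoffSkeleton M))) ∧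
      ∀ k : ℕ, ∃ m ∈ I',
        k < Nat.card (MulAction.orbitRel.Quotient (N m) (cs.WythoffVertex M)) := by
  set X := cs.wythoffSkeleton M with hX
  have hP := cs.finite_parabolic_compl hM hlink
  have hW : Infinite W := by
    by_contra h
    rw [not_infinite_iff_finite] at h
    exact hdef cs.isDefinite_of_finite
  have hI : Nonempty I := by
    by_contra h
    rw [not_nonempty_iff] at h
    rw [iInf_of_empty] at hbot
    exact top_ne_bot hbot
  have hVinf : Infinite (cs.WythoffVertex M) := by
    by_contra h
    rw [not_infinite_iff_finite] at h
    have := cs.finite_setOf_smul_mem hP (cs.baseVertex M) Set.finite_univ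
    simp only [Set.mem_univ] at this
    exact Set.infinite_univ this
  have hfinite (m : I) :
      Finite (MulAction.orbitRel.Quotient (N m) (cs.WythoffVertex M)) := by
    have := hnormal m
    have := hindex m
    exact finite_orbitRel_quotient_of_finiteIndex (N m) _
  -- The ball of radius `3` about the standard vertex.
  let nb : Set (cs.WythoffVertex M) → Set (cs.WythoffVertex M) :=
    fun S => ⋃ x ∈ S, insert x (X.neighborSet x)
  have hnb (S : Set (cs.WythoffVertex M)) (hS : S.Finite) : (nb S).Finite :=
    hS.biUnion fun x _ => (cs.finite_neighborSet hlink x).insert x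
  have hmem (S : Set (cs.WythoffVertex M)) (x y : cs.WythoffVertex M) (hx : x ∈ S)
      (h : x = y ∨ X.Adj x y) : y ∈ nb S := by
    refine Set.mem_biUnion hx ?_
    rcases h with rfl | h
    exacts [Set.mem_insert _ _, Set.mem_insert_of_mem _ h]
  have hsmul (g : W) (x y : cs.WythoffVertex M) (h : x = y ∨ X.Adj x y) :
      g • x = g • y ∨ X.Adj (g • x) (g • y) :=
    h.imp (congrArg _) (cs.smul_wythoffSkeleton_adj g)
  have hball : {g : W | g • cs.baseVertex M ∈ nb (nb (nb {cs.baseVertex M}))}.Finite :=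
    cs.finite_setOf_smul_mem hP _ (hnb _ (hnb _ (hnb _ (Set.finite_singleton _))))
  obtain ⟨m₀, hm₀⟩ := exists_forall_mem_imp_eq_one hinter hbot hball
  refine ⟨{m | N m ≤ N m₀}, fun m hm m' hm' => ?_, ?_, fun m hm => ⟨?_, ?_⟩, fun k => ?_⟩
  · obtain ⟨k, hk⟩ := hinter m m'
    exact ⟨k, by rw [Set.mem_ofPred_eq, hk]; exact inf_le_left.trans hm, hk⟩
  · refine eq_bot_iff.mpr (hbot ▸ le_iInf fun m => ?_)
    obtain ⟨k, hk⟩ := hinter m m₀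
    refine (iInf₂_le k ?_).trans (hk ▸ inf_le_left)
    rw [Set.mem_ofPred_eq, hk]
    exact inf_le_right
  · exact hfinite m
  · refine hreg.orbitGraph (fun n x y h => cs.smul_wythoffSkeleton_adj (n : W) h) ?_
    rintro ⟨n, hn⟩ x b c h1 h2 h3
    obtain ⟨w, hw⟩ : ∃ w : W, w • cs.baseVertex M = x := by
      obtain ⟨w, rfl⟩ := QuotientGroup.mk_surjective x
      exact ⟨w, by simp [CoxeterSystem.baseVertex]⟩
    change c = n • x ∨ X.Adj c (n • x) at h3
    change n • x = x
    have hx : w⁻¹ • x = cs.baseVertex M := by rw [← hw, inv_smul_smul]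
    have h4 : (w⁻¹ * n * w) • cs.baseVertex M ∈ nb (nb (nb {cs.baseVertex M})) := by
      refine hmem _ (w⁻¹ • c) _ (hmem _ (w⁻¹ • b) _ (hmem _ (w⁻¹ • x) _ (by simp [hx])
        (hsmul _ _ _ h1)) (hsmul _ _ _ h2)) ?_
      have := hsmul w⁻¹ _ _ h3
      rwa [mul_smul, mul_smul, hw]
    have h5 : w⁻¹ * n * w ∈ N m₀ := by
      have := (hnormal m₀).conj_mem n (hm hn) w⁻¹
      simpa using this
    have h6 := hm₀ _ h4 h5
    have h7 : n = 1 := by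
      have := congrArg (fun y => w * y * w⁻¹) h6
      simpa [mul_assoc] using this
    rw [h7, one_smul]
  · -- Separate the elements carrying one of `k + 1` chosen vertices to another.
    obtain ⟨T, hT⟩ := Infinite.exists_subset_card_eq (cs.WythoffVertex M) (k + 1)
    have hF : (⋃ x ∈ T, {g : W | g • x ∈ T}).Finite :=
      T.finite_toSet.biUnion fun x _ => cs.finite_setOf_smul_mem hP x T.finite_toSet
    obtain ⟨m₁, hm₁⟩ := exists_forall_mem_imp_eq_one hinter hbot hF
    obtain ⟨m, hm⟩ := hinter m₁ m₀
    refine ⟨m, by rw [Set.mem_ofPred_eq, hm]; exact inf_le_right, ?_⟩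
    have := hfinite m
    have hle := Nat.card_le_card_of_injective
      (fun x : T => (Quotient.mk'' x.1 :
        MulAction.orbitRel.Quotient (N m) (cs.WythoffVertex M))) ?_
    · rw [Nat.card_eq_fintype_card, Fintype.card_coe, hT] at hle
      exact hle
    · intro x y hxy
      obtain ⟨⟨n, hn⟩, hnx⟩ := Quotient.eq''.mp hxy
      change n • y.1 = x.1 at hnx
      rw [hm] at hn
      have h1 : n = 1 := hm₁ n (Set.mem_biUnion y.2 (by
        change n • y.1 ∈ T
        rw [hnx]
        exact x.2)) hn.1
      rw [h1, one_smul] at hnx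
      exact Subtype.ext hnx.symm
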